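/- Let $D$ be an integral domain with quotient field $K$, and let $X$ be an indeterminate over $K$. Let $\overline{\boldsymbol F}(D)$ be the set of nonzero $D$-submodules of $K$. A semistar operation on $D$ is a map $\star:\overline{\boldsymbol F}(D)\to\overline{\boldsymbol F}(D)$, $E\mapsto E^\star$, such that for all $0\neq x\in K$ and all $E,F\in\overline{\boldsymbol F}(D)$: $(xE)^\star=xE^\star$; $E\subseteq F$ implies $E^\star\subseteq F^\star$; and $E\subseteq E^\star=(E^\star)^\star$. The semistar operation $\star_f$ is defined by $E^{\star_f}=\bigcup\{F^\star : F\subseteq E,\ F \text{ a nonzero finitely generated } D\text{-submodule of } K\}$. We say that $\star$ is of finite type if $\star=\star_f$, and stable if $(E\cap F)^\star=E^\star\cap F^\star$ for all $E,F\in\overline{\boldsymbol F}(D)$. A quasi-$\star$-ideal is a nonzero ideal $I$ of $D$ with $I^\star\cap D=I$; a quasi-$\star$-maximal ideal is a maximal element of the set of proper quasi-$\star$-ideals (such an ideal is prime). $D$ is a Prüfer $\star$-multiplication domain (P$\star$MD) if $(II^{-1})^{\star_f}=D^{\star_f}$ for every nonzero finitely generated ideal $I$ of $D$, where $I^{-1}=\{z\in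 K: zI\subseteq D\}$. For $0\neq h\in K[X]$, let $\boldsymbol c_D(h)$ be the $D$-submodule of $K$ generated by the coefficients of $h$. **Theorem.** Let $\star$ be a stable semistar operation of finite type on $D$. The following are equivalent: (i) $\boldsymbol c_D(fg)^\star=(\boldsymbol c_D(f)\,\boldsymbol c_D(g))^\star$ for all nonzero $f,g\in K[X]$; (ii) $D_M$ is a valuation domain for every quasi-$\star$-maximal ideal $M$ of $D$; (iii) $D$ is a P$\star$MD. -/

import Mathlib

open Polynomial
open scoped Pointwise

/-- The nonzero `D`-submodules of `K`. -/
abbrev NonzeroSubmodule (D K : Type*) [CommRing D] [Field K] [Algebra D K] :=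
  {E : Submodule D K // E ≠ ⊥}

namespace NonzeroSubmodule

section Basic

variable {D K : Type*} [CommRing D] [Field K] [Algebra D K]

theorem exists_ne_zero (E : NonzeroSubmodule D K) : ∃ x ∈ E.1, x ≠ 0 :=
  Submodule.exists_mem_ne_zero_of_ne_bot E.2

theorem ne_bot_of_mem {E : Submodule D K} {x : K} (hx : x ∈ E) (h0 : x ≠ 0) : E ≠ ⊥ := by
  rintro rfl
  exact h0 ((Submodule.mem_bot D).1 hx)

/-- The submodule `D` of `K`. -/
instance : One (NonzeroSubmodule D K) :=
  ⟨⟨1, ne_bot_of_mem (x := 1) (Submodule.one_le.1 le_rfl) one_ne_zero⟩⟩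

/-- The product `E F`: the submodule generated by all `e * f`, for `e ∈ E` and `f ∈ F`. -/
instance : Mul (NonzeroSubmodule D K) :=
  ⟨fun E F => ⟨E.1 * F.1, by
    obtain ⟨x, hx, hx0⟩ := E.exists_ne_zero
    obtain ⟨y, hy, hy0⟩ := F.exists_ne_zero
    exact ne_bot_of_mem (Submodule.mul_mem_mul hx hy) (mul_ne_zero hx0 hy0)⟩⟩

/-- The submodule `x E = {x * e | e ∈ E}`, for `x ≠ 0` in `K`. -/
def scale (x : K) (hx : x ≠ 0) (E : NonzeroSubmodule D K) : NonzeroSubmodule D K :=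
  ⟨x • E.1, by
    obtain ⟨y, hy, hy0⟩ := E.exists_ne_zero
    exact ne_bot_of_mem (Submodule.smul_mem_pointwise_smul y x E.1 hy)
      (by simpa using And.intro hx hy0)⟩

/-- The content of a nonzero `h ∈ K[X]` with respect to `D`: the `D`-submodule of `K` generated
by the coefficients of `h`. -/
def content (D : Type*) {K : Type*} [CommRing D] [Field K] [Algebra D K]
    (h : K[X]) (hh : h ≠ 0) : NonzeroSubmodule D K :=
  ⟨Submodule.span D (h.coeffs : Set K), by
    refine ne_bot_of_mem (x := h.leadingCoeff) (Submodule.subset_span ?_)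
      (leadingCoeff_ne_zero.2 hh)
    exact coeff_mem_coeffs (leadingCoeff_ne_zero.2 hh)⟩

end Basic

section FractionField

variable {D K : Type*} [CommRing D] [Field K] [Algebra D K] [IsFractionRing D K]

/-- The intersection `E ∩ F`. -/
instance : Min (NonzeroSubmodule D K) :=
  ⟨fun E F => ⟨E.1 ⊓ F.1, by
    obtain ⟨x, hx, hx0⟩ := E.exists_ne_zero
    obtain ⟨y, hy, hy0⟩ := F.exists_ne_zero
    obtain ⟨a, b, hb, rfl⟩ := IsFractionRing.div_surjective (A := D) x
    obtain ⟨c, d, hd, rfl⟩ := IsFractionRing.div_surjective (A := D) y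
    have hb0 : algebraMap D K b ≠ 0 := fun h => hx0 (by simp [h])
    have hd0 : algebraMap D K d ≠ 0 := fun h => hy0 (by simp [h])
    have ha0 : algebraMap D K a ≠ 0 := fun h => hx0 (by simp [h])
    have hc0 : algebraMap D K c ≠ 0 := fun h => hy0 (by simp [h])
    refine ne_bot_of_mem (x := algebraMap D K a * algebraMap D K c) ⟨?_, ?_⟩
      (mul_ne_zero ha0 hc0)
    · have := E.1.smul_mem (b * c) hx
      rw [Algebra.smul_def, map_mul] at this
      have e : algebraMap D K a * algebraMap D K c = algebraMap D K b * algebraMap D K c *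
          (algebraMap D K a / algebraMap D K b) := by field_simp
      rw [e]
      exact this
    · have := F.1.smul_mem (d * a) hy
      rw [Algebra.smul_def, map_mul] at this
      have e : algebraMap D K a * algebraMap D K c = algebraMap D K d * algebraMap D K a *
          (algebraMap D K c / algebraMap D K d) := by field_simp
      rw [e]
      exact this⟩⟩

/-- A nonzero ideal of `D`, as a `D`-submodule of `K`. -/
def ofIdeal (K : Type*) {D : Type*} [CommRing D] [Field K] [Algebra D K] [IsFractionRing D K]
    (I : Ideal D) (hI : I ≠ ⊥) : NonzeroSubmodule D K :=
  ⟨Submodule.map (Algebra.linearMap D K) I, by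
    obtain ⟨x, hx, hx0⟩ := Submodule.exists_mem_ne_zero_of_ne_bot hI
    exact ne_bot_of_mem (Submodule.mem_map_of_mem hx)
      ((map_ne_zero_iff _ (IsFractionRing.injective D K)).2 hx0)⟩

/-- The inverse `I⁻¹ = (D : I) = {z ∈ K | z I ⊆ D}` of a nonzero ideal `I` of `D`. -/
def invIdeal (K : Type*) {D : Type*} [CommRing D] [Field K] [Algebra D K] [IsFractionRing D K]
    (I : Ideal D) (hI : I ≠ ⊥) : NonzeroSubmodule D K :=
  ⟨1 / (ofIdeal K I hI).1, by
    refine ne_bot_of_mem (x := 1) ?_ one_ne_zero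
    rw [Submodule.mem_div_iff_forall_mul_mem]
    rintro _ ⟨y, -, rfl⟩
    exact Submodule.mem_one.2 ⟨y, by simp⟩⟩

end FractionField

end NonzeroSubmodule

/-- A semistar operation on the domain `D` with quotient field `K`. -/
@[ext]
structure SemistarOperation (D K : Type*) [CommRing D] [Field K] [Algebra D K] where
  toFun : NonzeroSubmodule D K → NonzeroSubmodule D K
  map_scale : ∀ (x : K) (hx : x ≠ 0) (E : NonzeroSubmodule D K),
    toFun (E.scale x hx) = (toFun E).scale x hx
  mono : ∀ E F : NonzeroSubmodule D K, E ≤ F → toFun E ≤ toFun F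
  le_map : ∀ E : NonzeroSubmodule D K, E ≤ toFun E
  idem : ∀ E : NonzeroSubmodule D K, toFun (toFun E) = toFun E

namespace SemistarOperation

section Basic

variable {D K : Type*} [CommRing D] [Field K] [Algebra D K]

instance : CoeFun (SemistarOperation D K)
    (fun _ => NonzeroSubmodule D K → NonzeroSubmodule D K) :=
  ⟨toFun⟩

theorem exists_common (s : SemistarOperation D K) (F G : NonzeroSubmodule D K)
    (hF : F.1.FG) (hG : G.1.FG) (E : Submodule D K) (hFE : F.1 ≤ E) (hGE : G.1 ≤ E) :
    ∃ H : NonzeroSubmodule D K, H.1.FG ∧ H.1 ≤ E ∧ s F ≤ s H ∧ s G ≤ s H :=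
  ⟨⟨F.1 ⊔ G.1, fun h => F.2 (sup_eq_bot_iff.1 h).1⟩, hF.sup hG, sup_le hFE hGE,
    s.mono _ _ (Subtype.coe_le_coe.1 le_sup_left), s.mono _ _ (Subtype.coe_le_coe.1 le_sup_right)⟩

theorem exists_fg_mem (E : NonzeroSubmodule D K) {x : K} (hx : x ∈ E.1) :
    ∃ F : NonzeroSubmodule D K, F.1.FG ∧ F ≤ E ∧ x ∈ F.1 := by
  obtain ⟨y, hy, hy0⟩ := E.exists_ne_zero
  refine ⟨⟨Submodule.span D {x, y}, NonzeroSubmodule.ne_bot_of_mem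
    (Submodule.subset_span (by simp : y ∈ ({x, y} : Set K))) hy0⟩,
    Submodule.fg_span (by simp), ?_, Submodule.subset_span (by simp)⟩
  refine Subtype.coe_le_coe.1 (Submodule.span_le.2 ?_)
  rintro z (rfl | rfl)
  exacts [hx, hy]

/-- The value at `E` of the operation of finite type associated to `s`: the union of the `s F`
for `F` a nonzero finitely generated submodule contained in `E`. -/
def finiteTypeFun (s : SemistarOperation D K) (E : NonzeroSubmodule D K) :
    NonzeroSubmodule D K :=
  ⟨{ carrier := {x | ∃ F : NonzeroSubmodule D K, F.1.FG ∧ F ≤ E ∧ x ∈ (s F).1}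
     zero_mem' := by
       obtain ⟨F, hF, hFE, -⟩ := exists_fg_mem E E.1.zero_mem
       exact ⟨F, hF, hFE, (s F).1.zero_mem⟩
     add_mem' := by
       rintro x y ⟨F, hF, hFE, hx⟩ ⟨G, hG, hGE, hy⟩
       obtain ⟨H, hH, hHE, h1, h2⟩ := exists_common s F G hF hG E.1 hFE hGE
       exact ⟨H, hH, hHE, (s H).1.add_mem (h1 hx) (h2 hy)⟩
     smul_mem' := by
       rintro c x ⟨F, hF, hFE, hx⟩
       exact ⟨F, hF, hFE, (s F).1.smul_mem c hx⟩ }, by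
    obtain ⟨y, hy, hy0⟩ := E.exists_ne_zero
    obtain ⟨F, hF, hFE, hyF⟩ := exists_fg_mem E hy
    exact NonzeroSubmodule.ne_bot_of_mem (x := y) ⟨F, hF, hFE, s.le_map F hyF⟩ hy0⟩

theorem mem_finiteTypeFun {s : SemistarOperation D K} {E : NonzeroSubmodule D K} {x : K} :
    x ∈ (s.finiteTypeFun E).1 ↔
      ∃ F : NonzeroSubmodule D K, F.1.FG ∧ F ≤ E ∧ x ∈ (s F).1 :=
  Iff.rfl

theorem scale_mono (x : K) (hx : x ≠ 0) {E F : NonzeroSubmodule D K} (h : E ≤ F) :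
    E.scale x hx ≤ F.scale x hx :=
  Submodule.map_mono (f := DistribSMul.toLinearMap D K x) h

theorem scale_scale_inv (x : K) (hx : x ≠ 0) (E : NonzeroSubmodule D K) :
    (E.scale x hx).scale x⁻¹ (inv_ne_zero hx) = E :=
  Subtype.ext (inv_smul_smul₀ hx E.1)

theorem scale_inv_scale (x : K) (hx : x ≠ 0) (E : NonzeroSubmodule D K) :
    (E.scale x⁻¹ (inv_ne_zero hx)).scale x hx = E :=
  Subtype.ext (smul_inv_smul₀ hx E.1)

theorem fg_scale (x : K) (hx : x ≠ 0) {E : NonzeroSubmodule D K} (h : E.1.FG) :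
    (E.scale x hx).1.FG :=
  Submodule.FG.map (DistribSMul.toLinearMap D K x) h

theorem finiteTypeFun_scale_ge (s : SemistarOperation D K) (x : K) (hx : x ≠ 0)
    (E : NonzeroSubmodule D K) :
    (s.finiteTypeFun E).scale x hx ≤ s.finiteTypeFun (E.scale x hx) := by
  rintro _ ⟨y, ⟨F, hF, hFE, hy⟩, rfl⟩
  refine ⟨F.scale x hx, fg_scale x hx hF, scale_mono x hx hFE, ?_⟩
  rw [s.map_scale]
  exact Submodule.smul_mem_pointwise_smul y x _ hy

/-- The semistar operation of finite type associated to `s`. -/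
def finiteType (s : SemistarOperation D K) : SemistarOperation D K where
  toFun := s.finiteTypeFun
  map_scale x hx E := by
    refine le_antisymm ?_ (finiteTypeFun_scale_ge s x hx E)
    have h := scale_mono x hx
      (finiteTypeFun_scale_ge s x⁻¹ (inv_ne_zero hx) (E.scale x hx))
    rwa [scale_inv_scale, scale_scale_inv] at h
  mono E F h := by
    rintro x ⟨G, hG, hGE, hx⟩
    exact ⟨G, hG, hGE.trans h, hx⟩
  le_map E := by
    intro x hx
    obtain ⟨F, hF, hFE, hxF⟩ := exists_fg_mem E hx
    exact ⟨F, hF, hFE, s.le_map F hxF⟩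
  idem E := by
    have key : ∀ N : Submodule D K, N.FG → N ≤ (s.finiteTypeFun E).1 →
        ∃ G : NonzeroSubmodule D K, G.1.FG ∧ G ≤ E ∧ N ≤ (s G).1 := by
      intro N hN
      induction N, hN using Submodule.fg_induction with
      | singleton x =>
        intro hx
        obtain ⟨G, hG, hGE, hxG⟩ := hx (Submodule.mem_span_singleton_self x)
        exact ⟨G, hG, hGE, (Submodule.span_singleton_le_iff_mem _ _).2 hxG⟩
      | sup M N _ _ ihM ihN =>
        intro h
        obtain ⟨F, hF, hFE, hMF⟩ := ihM (le_sup_left.trans h)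
        obtain ⟨G, hG, hGE, hNG⟩ := ihN (le_sup_right.trans h)
        obtain ⟨H, hH, hHE, h1, h2⟩ := exists_common s F G hF hG E.1 hFE hGE
        exact ⟨H, hH, hHE, sup_le (hMF.trans h1) (hNG.trans h2)⟩
    apply le_antisymm
    · rintro x ⟨F, hF, hFE, hx⟩
      obtain ⟨G, hG, hGE, hFG⟩ := key F.1 hF hFE
      refine ⟨G, hG, hGE, ?_⟩
      have h := s.mono F (s G) hFG
      rw [s.idem] at h
      exact h hx
    · intro x hx
      obtain ⟨F, hF, hFE, hxF⟩ := exists_fg_mem (s.finiteTypeFun E) hx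
      exact ⟨F, hF, hFE, s.le_map F hxF⟩

/-- `s` is of finite type: it equals its associated operation of finite type. -/
def IsFiniteType (s : SemistarOperation D K) : Prop :=
  s = s.finiteType

end Basic

section FractionField

variable {D K : Type*} [CommRing D] [Field K] [Algebra D K] [IsFractionRing D K]

/-- `s` is stable: it commutes with finite intersections. -/
def IsStable (s : SemistarOperation D K) : Prop :=
  ∀ E F : NonzeroSubmodule D K, s (E ⊓ F) = s E ⊓ s F

/-- `I` is a quasi-`s`-ideal: a nonzero ideal of `D` with `(s I) ∩ D = I`. -/
def IsQuasiIdeal (s : SemistarOperation D K) (I : Ideal D) : Prop :=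
  ∃ hI : I ≠ ⊥,
    Submodule.comap (Algebra.linearMap D K) (s (NonzeroSubmodule.ofIdeal K I hI)).1 = I

/-- `M` is quasi-`s`-maximal: maximal among the proper quasi-`s`-ideals of `D`. -/
def IsQuasiMaximal (s : SemistarOperation D K) (M : Ideal D) : Prop :=
  Maximal (fun I : Ideal D => s.IsQuasiIdeal I ∧ I ≠ ⊤) M

/-- A nonzero ideal `I` is `s`-invertible: `s (I I⁻¹) = s D`. -/
def IsInvertible (s : SemistarOperation D K) (I : Ideal D) (hI : I ≠ ⊥) : Prop :=
  s (NonzeroSubmodule.ofIdeal K I hI * NonzeroSubmodule.invIdeal K I hI) = s 1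

/-- `D` is a Prüfer `s`-multiplication domain: every nonzero finitely generated ideal is
invertible for the operation of finite type associated to `s`. -/
def IsPruferMultiplicationDomain (s : SemistarOperation D K) : Prop :=
  ∀ (I : Ideal D) (hI : I ≠ ⊥), I.FG → s.finiteType.IsInvertible I hI

/-- Quasi-`s`-maximal ideals are prime, so that one may localize at them. -/
theorem IsQuasiMaximal.isPrime {s : SemistarOperation D K} {M : Ideal D}
    (hM : s.IsQuasiMaximal M) : M.IsPrime := by
  obtain ⟨⟨⟨hM0, hMq⟩, hMtop⟩, hmax⟩ := hM
  refine ⟨hMtop, ?_⟩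
  intro a b hab
  by_contra! hcon
  obtain ⟨ha, hb⟩ := hcon
  have hb0 : algebraMap D K b ≠ 0 := fun h => hb <| by
    rw [(map_eq_zero_iff _ (IsFractionRing.injective D K)).1 h]
    exact M.zero_mem
  set N : Ideal D := M ⊔ Ideal.span {a}
  have hN0 : N ≠ ⊥ := fun h => hM0 (eq_bot_iff.2 (h ▸ le_sup_left))
  set E := NonzeroSubmodule.ofIdeal K N hN0
  set J : Ideal D := Submodule.comap (Algebra.linearMap D K) (s E).1 with hJ
  have hNJ : N ≤ J := fun x hx => s.le_map E (Submodule.mem_map_of_mem hx)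
  have hJ0 : J ≠ ⊥ := fun h => hN0 (eq_bot_iff.2 (h ▸ hNJ))
  have hJq : s.IsQuasiIdeal J := by
    refine ⟨hJ0, le_antisymm ?_ fun x hx => s.le_map _ (Submodule.mem_map_of_mem hx)⟩
    have h : s (NonzeroSubmodule.ofIdeal K J hJ0) ≤ s (s E) :=
      s.mono _ _ (Submodule.map_comap_le _ _)
    rw [s.idem] at h
    exact Submodule.comap_mono h
  have haJ : a ∈ J := hNJ (Ideal.mem_sup_right (Ideal.mem_span_singleton_self a))
  have hJtop : J = ⊤ := by
    by_contra hne
    exact ha (hmax ⟨hJq, hne⟩ (le_sup_left.trans hNJ) haJ)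
  have h1 : (1 : K) ∈ (s E).1 := by
    have : (1 : D) ∈ J := hJtop ▸ Submodule.mem_top
    simpa [hJ] using this
  have hscale : E.scale (algebraMap D K b) hb0 ≤ NonzeroSubmodule.ofIdeal K M hM0 := by
    rintro _ ⟨_, ⟨x, hx, rfl⟩, rfl⟩
    refine ⟨b * x, ?_, by simp⟩
    obtain ⟨m, hm, y, hy, rfl⟩ := Submodule.mem_sup.1 hx
    obtain ⟨c, rfl⟩ := Ideal.mem_span_singleton'.1 hy
    rw [mul_add]
    refine M.add_mem (M.mul_mem_left b hm) ?_
    rw [show b * (c * a) = c * (a * b) by ring]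
    exact M.mul_mem_left c hab
  have hs := s.mono _ _ hscale
  rw [s.map_scale] at hs
  apply hb
  rw [← hMq]
  have := hs (Submodule.smul_mem_pointwise_smul (1 : K) (algebraMap D K b) (s E).1 h1)
  simpa using this

end FractionField

end SemistarOperation

/-! Everything rests on `mem_iff_forall_isQuasiMaximal`: for a stable operation of finite type, `s
E` is the intersection of the `E_M` over quasi-maximal `M`. Indeed `x ∈ s E` iff `1 ∈ s (E : x)` by
stability, iff `(E : x)` lies in no quasi-maximal ideal by finite type. Each condition can thus be
tested at one `M` at a time, with multipliers `t ∉ M` in place of localizations; `Ideal.DvdTotalAt`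
is the valuation property in that language. If `D_M` is a valuation domain, finitely generated
modules are locally principal. Polynomials then become primitive at `M` after scaling, so Gauss's
lemma gives the content formula, and finitely generated ideals are locally invertible. Conversely,
the content formula for `(bX + a)(-bX + a)` gives `t a b = r a² + q b²` with `t ∉ M`, which makes `r
a / b` a root of a monic quadratic over `D`; the formula for its factorization puts `r a / b` in
`D_M`, and divisibility follows. If `(a, b)` is invertible but neither generator divides the other
at `M`, then `I I⁻¹ ⊆ M`, a contradiction. -/

namespace NonzeroSubmodule

/-! ### Contents and conductor ideals. -/

section Basic

variable {D K : Type*} [CommRing D] [Field K] [Algebra D K]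

/-- The conductor ideal `(E : x) = {d ∈ D | d x ∈ E}`. -/
def conductor (E : NonzeroSubmodule D K) (x : K) : Ideal D :=
  Submodule.comap (LinearMap.toSpanSingleton D K x) E.1

theorem mem_conductor {E : NonzeroSubmodule D K} {x : K} {d : D} :
    d ∈ E.conductor x ↔ d • x ∈ E.1 :=
  Iff.rfl

theorem algebraMap_mem_one (d : D) : algebraMap D K d ∈ (1 : NonzeroSubmodule D K).1 :=
  Submodule.mem_one.2 ⟨d, rfl⟩

theorem mem_scale_inv {E : NonzeroSubmodule D K} {x : K} (hx : x ≠ 0) {y : K} :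
    y ∈ (E.scale x⁻¹ (inv_ne_zero hx)).1 ↔ y * x ∈ E.1 := by
  change y ∈ x⁻¹ • E.1 ↔ _
  constructor
  · rintro ⟨z, hz, rfl⟩
    have : x⁻¹ * z * x = z := by field_simp
    simpa [this] using hz
  · intro h
    refine ⟨y * x, h, ?_⟩
    change x⁻¹ * (y * x) = y
    field_simp

theorem coeff_mem_content {h : K[X]} (hh : h ≠ 0) (n : ℕ) : h.coeff n ∈ (content D h hh).1 := by
  by_cases hn : h.coeff n = 0
  · rw [hn]
    exact Submodule.zero_mem _
  · exact Submodule.subset_span (coeff_mem_coeffs hn)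

theorem content_le_iff {h : K[X]} (hh : h ≠ 0) {N : Submodule D K} :
    (content D h hh).1 ≤ N ↔ ∀ n, h.coeff n ∈ N := by
  refine ⟨fun H n => H (coeff_mem_content hh n), fun H => Submodule.span_le.2 ?_⟩
  intro x hx
  obtain ⟨n, -, rfl⟩ := mem_coeffs_iff.1 hx
  exact H n

theorem content_fg {h : K[X]} (hh : h ≠ 0) : (content D h hh).1.FG :=
  Submodule.fg_span (Finset.finite_toSet _)

theorem content_mul_le {f g : K[X]} (hf : f ≠ 0) (hg : g ≠ 0) :
    content D (f * g) (mul_ne_zero hf hg) ≤ content D f hf * content D g hg := by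
  refine (content_le_iff _).2 fun n => ?_
  rw [coeff_mul]
  exact Submodule.sum_mem _ fun p _ =>
    Submodule.mul_mem_mul (coeff_mem_content hf p.1) (coeff_mem_content hg p.2)

end Basic

section FractionField

variable {D K : Type*} [CommRing D] [Field K] [Algebra D K] [IsFractionRing D K]

theorem conductor_ne_bot (E : NonzeroSubmodule D K) {x : K} (hx : x ≠ 0) :
    E.conductor x ≠ ⊥ := by
  obtain ⟨y, ⟨hy, hyD⟩, hy0⟩ := (E.scale x⁻¹ (inv_ne_zero hx) ⊓ 1).exists_ne_zero
  obtain ⟨d, rfl⟩ := Submodule.mem_one.1 hyD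
  refine fun h => hy0 ?_
  have hd : d ∈ E.conductor x := by
    rw [mem_conductor, Algebra.smul_def]
    exact (mem_scale_inv hx).1 hy
  rw [h] at hd
  rw [(Submodule.mem_bot D).1 hd, map_zero]

/-- Writing the conductor as an intersection is what lets stability compute its closure. -/
theorem ofIdeal_conductor (E : NonzeroSubmodule D K) {x : K} (hx : x ≠ 0) :
    ofIdeal K (E.conductor x) (E.conductor_ne_bot hx) =
      E.scale x⁻¹ (inv_ne_zero hx) ⊓ 1 := by
  refine Subtype.ext (Submodule.ext fun y => ⟨?_, ?_⟩)
  · rintro ⟨d, hd, rfl⟩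
    refine ⟨(mem_scale_inv hx).2 ?_, algebraMap_mem_one d⟩
    rw [SetLike.mem_coe, mem_conductor, Algebra.smul_def] at hd
    exact hd
  · rintro ⟨hy, hyD⟩
    obtain ⟨d, rfl⟩ := Submodule.mem_one.1 hyD
    refine ⟨d, ?_, rfl⟩
    rw [SetLike.mem_coe, mem_conductor, Algebra.smul_def]
    exact (mem_scale_inv hx).1 hy

theorem ofIdeal_mono {I J : Ideal D} (hI : I ≠ ⊥) (hJ : J ≠ ⊥) (h : I ≤ J) :
    ofIdeal K I hI ≤ ofIdeal K J hJ :=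
  Submodule.map_mono h

end FractionField

end NonzeroSubmodule

/-! ### Quasi-maximal ideals and the local description of `s`. -/

namespace SemistarOperation

theorem IsFiniteType.exists_fg {D K : Type*} [CommRing D] [Field K] [Algebra D K]
    {s : SemistarOperation D K}
    (hs : s.IsFiniteType) {E : NonzeroSubmodule D K} {x : K} (hx : x ∈ (s E).1) :
    ∃ F : NonzeroSubmodule D K, F.1.FG ∧ F ≤ E ∧ x ∈ (s F).1 := by
  rw [hs] at hx
  exact hx

variable {D K : Type*} [CommRing D] [Field K] [Algebra D K] [IsFractionRing D K]

open NonzeroSubmodule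

theorem one_mem_iff (s : SemistarOperation D K) (I : Ideal D) (hI : I ≠ ⊥) :
    (1 : K) ∈ (s (ofIdeal K I hI)).1 ↔
      Submodule.comap (Algebra.linearMap D K) (s (ofIdeal K I hI)).1 = ⊤ := by
  refine Iff.trans ?_ (Ideal.eq_top_iff_one _).symm
  simp

/-- The quasi-`s`-closure `(s I) ∩ D` of an ideal is a quasi-`s`-ideal. -/
theorem isQuasiIdeal_comap (s : SemistarOperation D K) (I : Ideal D) (hI : I ≠ ⊥) :
    s.IsQuasiIdeal (Submodule.comap (Algebra.linearMap D K) (s (ofIdeal K I hI)).1) := by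
  set J : Ideal D := Submodule.comap (Algebra.linearMap D K) (s (ofIdeal K I hI)).1
  have hIJ : I ≤ J := fun x hx => s.le_map _ (Submodule.mem_map_of_mem hx)
  have hJ : J ≠ ⊥ := fun h => hI (eq_bot_iff.2 (h ▸ hIJ))
  refine ⟨hJ, le_antisymm ?_ fun x hx => s.le_map _ (Submodule.mem_map_of_mem hx)⟩
  have h : s (ofIdeal K J hJ) ≤ s (s (ofIdeal K I hI)) :=
    s.mono _ _ (Submodule.map_comap_le _ _)
  rw [s.idem] at h
  exact Submodule.comap_mono h

/-- For an operation of finite type, each proper ideal in the quasi-`s` sense lies in a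
quasi-`s`-maximal ideal. -/
theorem IsFiniteType.exists_le_isQuasiMaximal {s : SemistarOperation D K} (hs : s.IsFiniteType)
    {I : Ideal D} (hI : I ≠ ⊥) (h1 : (1 : K) ∉ (s (ofIdeal K I hI)).1) :
    ∃ M, s.IsQuasiMaximal M ∧ I ≤ M := by
  -- Zorn is run on the ideals with `1 ∉ s J` rather than on proper quasi-ideals: the union of a
  -- chain then need not be shown closed.
  obtain ⟨M, hIM, ⟨hM0, hM1⟩, hmax⟩ := zorn_le_nonempty₀
    {J : Ideal D | ∃ hJ : J ≠ ⊥, (1 : K) ∉ (s (ofIdeal K J hJ)).1} (by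
      intro c hc hchain J₀ hJ₀
      have hle : J₀ ≤ sSup c := le_sSup hJ₀
      have h0 : sSup c ≠ ⊥ := fun h => (hc hJ₀).1 (eq_bot_iff.2 (h ▸ hle))
      refine ⟨sSup c, ⟨h0, fun h => ?_⟩, fun _ => le_sSup⟩
      -- Finite type: `1` already lies in the closure of a finitely generated ideal, which is
      -- contained in one member of the chain.
      obtain ⟨F, hF, hFE, h1F⟩ := hs.exists_fg h
      have hmap : (Submodule.comap (Algebra.linearMap D K) F.1).map (Algebra.linearMap D K)
          = F.1 := by
        rw [Submodule.map_comap_eq_self]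
        exact le_trans (Subtype.coe_le_coe.2 hFE) LinearMap.map_le_range
      have hfg : (Submodule.comap (Algebra.linearMap D K) F.1).FG :=
        Submodule.fg_of_fg_map_injective _ (IsFractionRing.injective D K) (hmap ▸ hF)
      have hFc : Submodule.comap (Algebra.linearMap D K) F.1 ≤ sSup c := by
        intro x hx
        obtain ⟨y, hy, hxy⟩ := hFE hx
        exact IsFractionRing.injective D K hxy ▸ hy
      obtain ⟨J, hJc, hFJ⟩ := CompleteLattice.isCompactElement_iff_le_of_directed_sSup_le _ _ |>.1
        ((Submodule.fg_iff_compact _).1 hfg) c ⟨J₀, hJ₀⟩ hchain.directedOn hFc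
      obtain ⟨hJ, h1J⟩ := hc hJc
      refine h1J (s.mono F _ ?_ h1F)
      exact Subtype.coe_le_coe.1 (hmap ▸ Submodule.map_mono hFJ)) I ⟨hI, h1⟩
  refine ⟨M, ⟨⟨?_, ?_⟩, ?_⟩, hIM⟩
  -- The quasi-closure of `M` still has no `1` in its closure, so maximality forces it to equal `M`.
  · have hq := s.isQuasiIdeal_comap M hM0
    have hle : M ≤ Submodule.comap (Algebra.linearMap D K) (s (ofIdeal K M hM0)).1 :=
      fun x hx => s.le_map _ (Submodule.mem_map_of_mem hx)
    obtain ⟨h0, hq'⟩ := hq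
    refine ⟨hM0, le_antisymm (hmax ⟨h0, fun h => ?_⟩ hle) hle⟩
    rw [one_mem_iff, hq', ← one_mem_iff] at h
    exact hM1 h
  · rintro rfl
    exact hM1 (s.le_map _ ⟨1, Submodule.mem_top, by simp⟩)
  · rintro J ⟨⟨hJ0, hJq⟩, hJtop⟩ hMJ
    refine hmax ⟨hJ0, fun h => hJtop ?_⟩ hMJ
    rwa [one_mem_iff, hJq] at h

theorem IsQuasiMaximal.one_notMem {s : SemistarOperation D K} {M : Ideal D}
    (hM : s.IsQuasiMaximal M) {I : Ideal D} (hI : I ≠ ⊥) (hIM : I ≤ M) :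
    (1 : K) ∉ (s (ofIdeal K I hI)).1 := by
  obtain ⟨⟨⟨hM0, hq⟩, htop⟩, -⟩ := hM
  intro h
  have := s.mono _ _ (ofIdeal_mono hI hM0 hIM) h
  rw [one_mem_iff, hq] at this
  exact htop this

/-- For a stable operation of finite type, `s E` is the intersection of the localizations of `E`
at the quasi-`s`-maximal ideals. -/
theorem mem_iff_forall_isQuasiMaximal {s : SemistarOperation D K} (hstable : s.IsStable)
    (hfin : s.IsFiniteType) (E : NonzeroSubmodule D K) (x : K) :
    x ∈ (s E).1 ↔ ∀ M, s.IsQuasiMaximal M → ∃ t ∉ M, t • x ∈ E.1 := by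
  by_cases hx : x = 0
  · subst hx
    refine ⟨fun _ M hM => ⟨1, fun h => hM.prop.2 ((Ideal.eq_top_iff_one M).2 h), by simp⟩,
      fun _ => (s E).1.zero_mem⟩
  have key : x ∈ (s E).1 ↔
      (1 : K) ∈ (s (ofIdeal K (E.conductor x) (E.conductor_ne_bot hx))).1 := by
    rw [ofIdeal_conductor E hx, hstable, s.map_scale]
    change _ ↔ 1 ∈ ((s E).scale x⁻¹ (inv_ne_zero hx)).1 ∧ 1 ∈ (s 1).1
    rw [mem_scale_inv hx, one_mul]
    refine (and_iff_left (s.le_map 1 ?_)).symm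
    simpa using algebraMap_mem_one (K := K) (1 : D)
  rw [key]
  constructor
  · intro h M hM
    by_contra! hcon
    exact hM.one_notMem (E.conductor_ne_bot hx) (fun t ht => by_contra fun htM => hcon t htM ht) h
  · intro h
    by_contra h1
    obtain ⟨M, hM, hle⟩ := hfin.exists_le_isQuasiMaximal _ h1
    obtain ⟨t, htM, ht⟩ := h M hM
    exact htM (hle ht)

theorem le_of_forall_isQuasiMaximal {s : SemistarOperation D K} (hstable : s.IsStable)
    (hfin : s.IsFiniteType) {E F : NonzeroSubmodule D K}
    (h : ∀ x ∈ E.1, ∀ M, s.IsQuasiMaximal M → ∃ t ∉ M, t • x ∈ F.1) : s E ≤ s F := by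
  have : E ≤ s F := fun x hx => (mem_iff_forall_isQuasiMaximal hstable hfin F x).2 (h x hx)
  simpa only [s.idem] using s.mono _ _ this

end SemistarOperation

/-! ### Valuation localizations, expressed inside `D`. -/

/-- Divisibility is total in `D` up to multipliers outside `P`. -/
def Ideal.DvdTotalAt {D : Type*} [CommRing D] (P : Ideal D) : Prop :=
  ∀ a b : D, ∃ t ∉ P, b ∣ t * a ∨ a ∣ t * b

namespace Ideal

variable {D : Type*} [CommRing D] [IsDomain D]

theorem algebraMap_dvd_iff {P : Ideal D} [P.IsPrime] {a b : D} :
    algebraMap D (Localization.AtPrime P) a ∣ algebraMap D (Localization.AtPrime P) b ↔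
      ∃ t ∉ P, a ∣ t * b := by
  have hinj : Function.Injective (algebraMap D (Localization.AtPrime P)) :=
    IsLocalization.injective _ P.primeCompl_le_nonZeroDivisors
  constructor
  · rintro ⟨z, hz⟩
    obtain ⟨⟨c, t⟩, hc⟩ := IsLocalization.surj P.primeCompl z
    refine ⟨t, t.2, c, hinj ?_⟩
    rw [map_mul, map_mul, hz, ← hc]
    ring
  · rintro ⟨t, ht, c, hc⟩
    have hu : IsUnit (algebraMap D (Localization.AtPrime P) t) :=
      IsLocalization.map_units _ (⟨t, ht⟩ : P.primeCompl)
    refine (hu.dvd_mul_left).1 ?_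
    rw [← map_mul, hc, map_mul]
    exact dvd_mul_right _ _

theorem valuationRing_localization_iff (P : Ideal D) [P.IsPrime] :
    ValuationRing (Localization.AtPrime P) ↔ P.DvdTotalAt := by
  rw [ValuationRing.iff_dvd_total]
  constructor
  · rintro ⟨h⟩ a b
    rcases h (algebraMap D _ a) (algebraMap D _ b) with h | h <;>
      obtain ⟨t, ht, h⟩ := algebraMap_dvd_iff.1 h
    exacts [⟨t, ht, Or.inr h⟩, ⟨t, ht, Or.inl h⟩]
  · refine fun h => ⟨fun x y => ?_⟩
    obtain ⟨⟨a, u⟩, ha⟩ := IsLocalization.surj P.primeCompl x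
    obtain ⟨⟨b, v⟩, hb⟩ := IsLocalization.surj P.primeCompl y
    have hu := IsLocalization.map_units (Localization.AtPrime P) u
    have hv := IsLocalization.map_units (Localization.AtPrime P) v
    have hxy : x ∣ y ↔ algebraMap D (Localization.AtPrime P) a ∣ algebraMap D _ b := by
      rw [← ha, ← hb, hu.mul_right_dvd, hv.dvd_mul_right]
    have hyx : y ∣ x ↔ algebraMap D (Localization.AtPrime P) b ∣ algebraMap D _ a := by
      rw [← ha, ← hb, hv.mul_right_dvd, hu.dvd_mul_right]
    rw [hxy, hyx, algebraMap_dvd_iff, algebraMap_dvd_iff]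
    obtain ⟨t, ht, h | h⟩ := h a b
    exacts [Or.inr ⟨t, ht, h⟩, Or.inl ⟨t, ht, h⟩]

end Ideal

/-! ### Local principality and Gauss's lemma at a prime. -/

namespace Ideal.DvdTotalAt

variable {D K : Type*} [CommRing D] [Field K] [Algebra D K] [IsFractionRing D K] {P : Ideal D}

/-- Totality passes from `D` to its quotient field. -/
theorem exists_smul (h : P.DvdTotalAt) [P.IsPrime] (x y : K) :
    ∃ t ∉ P, (∃ c : D, t • x = c • y) ∨ ∃ c : D, t • y = c • x := by
  obtain ⟨a, u, hu, rfl⟩ := IsFractionRing.div_surjective (A := D) x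
  obtain ⟨b, v, hv, rfl⟩ := IsFractionRing.div_surjective (A := D) y
  have : Nontrivial D := (algebraMap D K).domain_nontrivial
  have hu0 : algebraMap D K u ≠ 0 := IsFractionRing.to_map_ne_zero_of_mem_nonZeroDivisors hu
  have hv0 : algebraMap D K v ≠ 0 := IsFractionRing.to_map_ne_zero_of_mem_nonZeroDivisors hv
  -- Comparing `a / u` with `b / v` amounts to comparing the cross products.
  obtain ⟨t, ht, ⟨c, hc⟩ | ⟨c, hc⟩⟩ := h (a * v) (b * u) <;>
    refine ⟨t, ht, ?_⟩ <;> have hc := congrArg (algebraMap D K) hc <;>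
    simp only [map_mul] at hc
  · refine Or.inl ⟨c, ?_⟩
    rw [Algebra.smul_def, Algebra.smul_def]
    field_simp
    linear_combination hc
  · refine Or.inr ⟨c, ?_⟩
    rw [Algebra.smul_def, Algebra.smul_def]
    field_simp
    linear_combination hc

/-- A finitely generated submodule of `K` is locally principal. -/
theorem exists_smul_mem_span (h : P.DvdTotalAt) [P.IsPrime] {N : Submodule D K} (hN : N.FG) :
    ∃ a ∈ N, ∃ t ∉ P, ∀ x ∈ N, t • x ∈ Submodule.span D {a} := by
  induction N, hN using Submodule.fg_induction with
  | singleton a =>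
    refine ⟨a, Submodule.mem_span_singleton_self a, 1, P.one_notMem, fun x hx => ?_⟩
    rwa [one_smul]
  | sup N₁ N₂ _ _ ih₁ ih₂ =>
    obtain ⟨a₁, ha₁, t₁, ht₁, h₁⟩ := ih₁
    obtain ⟨a₂, ha₂, t₂, ht₂, h₂⟩ := ih₂
    -- If `u • a'` is a multiple of `a`, then `a` alone generates the sum locally; it is stated
    -- symmetrically to serve both outcomes of comparing the generators.
    have key : ∀ {N N' : Submodule D K} {a a' : K} {t t' u c : D},
        (∀ x ∈ N, t • x ∈ Submodule.span D {a}) → (∀ x ∈ N', t' • x ∈ Submodule.span D {a'}) →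
        u • a' = c • a → ∀ x ∈ N ⊔ N', (u * t * t') • x ∈ Submodule.span D {a} := by
      intro N N' a a' t t' u c hN hN' hu x hx
      obtain ⟨y, hy, z, hz, rfl⟩ := Submodule.mem_sup.1 hx
      rw [smul_add]
      refine Submodule.add_mem _ ?_ ?_
      · rw [mul_right_comm, mul_smul]
        exact Submodule.smul_mem _ _ (hN y hy)
      · obtain ⟨d, hd⟩ := Submodule.mem_span_singleton.1 (hN' z hz)
        refine Submodule.mem_span_singleton.2 ⟨t * d * c, ?_⟩
        simp only [Algebra.smul_def, map_mul] at hd hu ⊢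
        linear_combination (-algebraMap D K t * algebraMap D K d) * hu +
          (algebraMap D K u * algebraMap D K t) * hd
    obtain ⟨u, hu, ⟨c, hc⟩ | ⟨c, hc⟩⟩ := h.exists_smul a₁ a₂
    · refine ⟨a₂, Submodule.mem_sup_right ha₂, u * t₂ * t₁,
        P.primeCompl.mul_mem (P.primeCompl.mul_mem hu ht₂) ht₁, ?_⟩
      rw [sup_comm]
      exact key h₂ h₁ hc
    · exact ⟨a₁, Submodule.mem_sup_left ha₁, u * t₁ * t₂,
        P.primeCompl.mul_mem (P.primeCompl.mul_mem hu ht₁) ht₂, key h₁ h₂ hc⟩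

/-- A polynomial over `K` is, up to scaling, the image of a polynomial over `D` which does not
vanish modulo `P`, the scaling factor being a content element over an element outside `P`. -/
theorem exists_primitive (h : P.DvdTotalAt) [P.IsPrime] {f : K[X]} (hf : f ≠ 0) :
    ∃ a : K, ∃ t ∉ P, ∃ F : D[X], F ∉ Ideal.map (C : D →+* D[X]) P ∧
      C (algebraMap D K t) * f = C a * F.map (algebraMap D K) := by
  obtain ⟨a, ha, t, ht, hat⟩ :=
    h.exists_smul_mem_span (NonzeroSubmodule.content_fg (D := D) hf)
  have hcoeff : ∀ n, ∃ c : D, c • a = t • f.coeff n := fun n =>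
    Submodule.mem_span_singleton.1 (hat _ (NonzeroSubmodule.coeff_mem_content hf n))
  choose c hc using hcoeff
  have ht0 : algebraMap D K t ≠ 0 := fun h0 => ht <| by
    rw [(map_eq_zero_iff _ (IsFractionRing.injective D K)).1 h0]
    exact P.zero_mem
  have ha0 : a ≠ 0 := by
    rintro rfl
    refine hf (Polynomial.ext fun n => ?_)
    have := hc n
    rw [smul_zero, Algebra.smul_def] at this
    simpa [ht0] using this.symm
  -- The coefficients of `F` are those of `t f / a`.
  set F : D[X] := ∑ n ∈ f.support, monomial n (c n) with hF
  have hFc : ∀ n, algebraMap D K (F.coeff n) * a = algebraMap D K t * f.coeff n := by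
    intro n
    rw [← Algebra.smul_def, ← Algebra.smul_def]
    by_cases hn : n ∈ f.support
    · rw [hF, finsetSum_coeff, Finset.sum_eq_single n, coeff_monomial_same, hc]
      · exact fun m _ hmn => coeff_monomial_of_ne _ hmn.symm
      · exact fun h => absurd hn h
    · rw [hF, finsetSum_coeff, Finset.sum_eq_zero, zero_smul, notMem_support_iff.1 hn, smul_zero]
      exact fun m hm => coeff_monomial_of_ne _ (by rintro rfl; exact hn hm)
  refine ⟨a, t, ht, F, fun hFP => ?_, ?_⟩
  -- Were all coefficients of `F` in `P`, then `t • content f ⊆ P a`. Since `a` is in the content,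
  -- `t a ∈ P a` and `t ∈ P`.
  · rw [Ideal.mem_map_C_iff] at hFP
    have hle : (NonzeroSubmodule.content D f hf).1 ≤
        Submodule.comap (LinearMap.lsmul D K t)
          (Submodule.map (LinearMap.toSpanSingleton D K a) P) := by
      refine (NonzeroSubmodule.content_le_iff hf).2 fun n => ⟨F.coeff n, hFP n, ?_⟩
      simpa [Algebra.smul_def] using hFc n
    obtain ⟨p, hp, hpa⟩ := hle ha
    have hpt : p = t := IsFractionRing.injective D K (mul_right_cancel₀ ha0 (by
      simpa [Algebra.smul_def] using hpa))
    exact ht (hpt ▸ hp)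
  · ext n
    rw [coeff_C_mul, coeff_C_mul, coeff_map, ← hFc n, mul_comm]

end Ideal.DvdTotalAt

namespace Ideal.DvdTotalAt

variable {D K : Type*} [CommRing D] [Field K] [Algebra D K] [IsFractionRing D K] {P : Ideal D}

/-- The content formula holds locally at a prime with total divisibility. -/
theorem exists_smul_mem_content_mul (h : P.DvdTotalAt) [P.IsPrime] {f g : K[X]} (hf : f ≠ 0)
    (hg : g ≠ 0) :
    ∃ t ∉ P, ∀ x ∈ (NonzeroSubmodule.content D f hf * NonzeroSubmodule.content D g hg).1,
      t • x ∈ (NonzeroSubmodule.content D (f * g) (mul_ne_zero hf hg)).1 := by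
  obtain ⟨a, t, ht, F, hFP, hF⟩ := h.exists_primitive hf
  obtain ⟨b, u, hu, G, hGP, hG⟩ := h.exists_primitive hg
  -- Gauss's lemma: the extension of a prime to `D[X]` is prime, so some coefficient of `F * G`
  -- avoids `P`.
  have hFG : F * G ∉ Ideal.map (C : D →+* D[X]) P := fun hFG =>
    (Ideal.IsPrime.mem_or_mem inferInstance hFG).elim hFP hGP
  rw [Ideal.mem_map_C_iff, not_forall] at hFG
  obtain ⟨k, hk⟩ := hFG
  refine ⟨(F * G).coeff k * t * u, P.primeCompl.mul_mem (P.primeCompl.mul_mem hk ht) hu, ?_⟩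
  suffices hle : (NonzeroSubmodule.content D f hf).1 * (NonzeroSubmodule.content D g hg).1 ≤
      Submodule.comap (LinearMap.lsmul D K ((F * G).coeff k * t * u))
        (NonzeroSubmodule.content D (f * g) (mul_ne_zero hf hg)).1 from hle
  have hk : algebraMap D K t * algebraMap D K u * (f * g).coeff k =
      a * b * algebraMap D K ((F * G).coeff k) := by
    have e : C (algebraMap D K t * algebraMap D K u) * (f * g) =
        C (a * b) * (F * G).map (algebraMap D K) := by
      rw [C_mul, C_mul, Polynomial.map_mul]
      linear_combination (C (algebraMap D K u) * g) * hF +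
        (C a * F.map (algebraMap D K)) * hG
    have := congrArg (coeff · k) e
    simpa only [coeff_C_mul, coeff_map] using this
  have hcoeff : ∀ m n, (LinearMap.lsmul D K ((F * G).coeff k * t * u)) (f.coeff m * g.coeff n) ∈
      (NonzeroSubmodule.content D (f * g) (mul_ne_zero hf hg)).1 := by
    intro m n
    have hm := congrArg (coeff · m) hF
    have hn := congrArg (coeff · n) hG
    simp only [coeff_C_mul, coeff_map] at hm hn
    -- Combine `t u f_m g_n = a b F_m G_n` with `a b (FG)_k = t u (fg)_k`: the single coefficient
    -- `(fg)_k` generates the product locally.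
    have e : (LinearMap.lsmul D K ((F * G).coeff k * t * u)) (f.coeff m * g.coeff n) =
        (F.coeff m * G.coeff n * t * u) • (f * g).coeff k := by
      rw [LinearMap.lsmul_apply, Algebra.smul_def, Algebra.smul_def]
      simp only [map_mul (algebraMap D K)]
      linear_combination (algebraMap D K ((F * G).coeff k) * algebraMap D K u * g.coeff n) * hm +
        (algebraMap D K ((F * G).coeff k) * a * algebraMap D K (F.coeff m)) * hn -
        (algebraMap D K (F.coeff m) * algebraMap D K (G.coeff n)) * hk
    rw [e]
    exact Submodule.smul_mem _ _ (NonzeroSubmodule.coeff_mem_content _ k)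
  refine Submodule.mul_le.2 fun x hx y hy => ?_
  have h1 : (NonzeroSubmodule.content D f hf).1 ≤ Submodule.comap
      (LinearMap.mulRight D y) (Submodule.comap (LinearMap.lsmul D K ((F * G).coeff k * t * u))
        (NonzeroSubmodule.content D (f * g) (mul_ne_zero hf hg)).1) := by
    refine (NonzeroSubmodule.content_le_iff hf).2 fun m => ?_
    have h2 : (NonzeroSubmodule.content D g hg).1 ≤ Submodule.comap
        (LinearMap.mulLeft D (f.coeff m))
          (Submodule.comap (LinearMap.lsmul D K ((F * G).coeff k * t * u))
            (NonzeroSubmodule.content D (f * g) (mul_ne_zero hf hg)).1) :=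
      (NonzeroSubmodule.content_le_iff hg).2 fun n => hcoeff m n
    exact h2 hy
  exact h1 hx

end Ideal.DvdTotalAt

/-! ### The implications between the three conditions. -/

namespace SemistarOperation

variable {D K : Type*} [CommRing D] [Field K] [Algebra D K] [IsFractionRing D K]

open NonzeroSubmodule

theorem eq_content_mul_of_dvdTotalAt {s : SemistarOperation D K} (hstable : s.IsStable)
    (hfin : s.IsFiniteType) (h : ∀ M, s.IsQuasiMaximal M → M.DvdTotalAt) {f g : K[X]}
    (hf : f ≠ 0) (hg : g ≠ 0) :
    s (content D (f * g) (mul_ne_zero hf hg)) = s (content D f hf * content D g hg) := by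
  refine le_antisymm (s.mono _ _ (content_mul_le hf hg))
    (le_of_forall_isQuasiMaximal hstable hfin fun x hx M hM => ?_)
  have := hM.isPrime
  obtain ⟨t, ht, H⟩ := (h M hM).exists_smul_mem_content_mul hf hg
  exact ⟨t, ht, H x hx⟩

/-- The content formula for `s` holds after localization at a quasi-`s`-maximal ideal. -/
theorem exists_smul_mem_content_mul {s : SemistarOperation D K} (hstable : s.IsStable)
    (hfin : s.IsFiniteType)
    (h : ∀ (f g : K[X]) (hf : f ≠ 0) (hg : g ≠ 0),
        s (content D (f * g) (mul_ne_zero hf hg)) = s (content D f hf * content D g hg))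
    {M : Ideal D} (hM : s.IsQuasiMaximal M) {f g : K[X]} (hf : f ≠ 0) (hg : g ≠ 0) (m n : ℕ)
    {N : Submodule D K} (hN : ∀ k, (f * g).coeff k ∈ N) :
    ∃ t ∉ M, t • (f.coeff m * g.coeff n) ∈ N := by
  have hmem : f.coeff m * g.coeff n ∈ (s (content D (f * g) (mul_ne_zero hf hg))).1 := by
    rw [h f g hf hg]
    exact s.le_map _ (Submodule.mul_mem_mul (coeff_mem_content hf m) (coeff_mem_content hg n))
  obtain ⟨t, ht, htN⟩ := (mem_iff_forall_isQuasiMaximal hstable hfin _ _).1 hmem M hM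
  exact ⟨t, ht, (content_le_iff _).2 hN htN⟩

/-- Two applications of the content formula: the first yields a quadratic relation between `a` and
`b`, the second is integral closedness of `D_M` for that quadratic. -/
theorem dvdTotalAt_of_eq_content_mul {s : SemistarOperation D K} (hstable : s.IsStable)
    (hfin : s.IsFiniteType)
    (h : ∀ (f g : K[X]) (hf : f ≠ 0) (hg : g ≠ 0),
        s (content D (f * g) (mul_ne_zero hf hg)) = s (content D f hf * content D g hg))
    {M : Ideal D} (hM : s.IsQuasiMaximal M) : M.DvdTotalAt := by
  have := hM.isPrime
  intro a b
  by_cases ha : a = 0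
  · exact ⟨1, M.one_notMem, Or.inl (by simp [ha])⟩
  by_cases hb : b = 0
  · exact ⟨1, M.one_notMem, Or.inr (by simp [hb])⟩
  have hinj := IsFractionRing.injective D K
  have ha0 : algebraMap D K a ≠ 0 := (map_ne_zero_iff _ hinj).2 ha
  have hb0 : algebraMap D K b ≠ 0 := (map_ne_zero_iff _ hinj).2 hb
  set α := algebraMap D K a
  set β := algebraMap D K b
  -- The sign kills the middle term of the product, so its content involves only `α²` and `β²`,
  -- while `αβ` is a product of coefficients.
  have hf : C β * X + C α ≠ 0 := fun e => hb0 (by simpa using congrArg (coeff · 1) e)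
  have hg : C (-β) * X + C α ≠ 0 := fun e => hb0 (by simpa using congrArg (coeff · 1) e)
  obtain ⟨t, ht, hmem⟩ := exists_smul_mem_content_mul hstable hfin h hM hf hg 1 0
    (N := Submodule.span D {α ^ 2, β ^ 2}) (by
      have e : (C β * X + C α) * (C (-β) * X + C α) = C (α ^ 2) - C (β ^ 2) * X ^ 2 := by
        simp only [C_neg, C_pow]
        ring
      intro k
      rw [e, coeff_sub, coeff_C_mul, coeff_C, coeff_X_pow]
      refine Submodule.sub_mem _ ?_ ?_ <;> split_ifs
      · exact Submodule.subset_span (by simp)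
      · exact Submodule.zero_mem _
      · rw [mul_one]
        exact Submodule.subset_span (by simp)
      · rw [mul_zero]
        exact Submodule.zero_mem _)
  obtain ⟨r, q, hrq⟩ := Submodule.mem_span_pair.1 hmem
  simp only [Algebra.smul_def, coeff_add, coeff_C_mul, coeff_X_one, coeff_C_succ, coeff_X_zero,
    coeff_C_zero, mul_one, mul_zero, add_zero, zero_add] at hrq
  set ρ := algebraMap D K r
  set τ := algebraMap D K t
  set κ := algebraMap D K q
  -- By `hrq`, `z = ρα/β` satisfies `z (τ - z) = ρκ`, so these factors multiply to `X² - tX + rq`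
  -- over `D`. The formula then gives `u z ∈ D` for some `u ∉ M`.
  have hf' : X + C (-(ρ * α / β)) ≠ 0 := X_add_C_ne_zero _
  have hg' : X + C (-(τ - ρ * α / β)) ≠ 0 := X_add_C_ne_zero _
  obtain ⟨u, hu, humem⟩ := exists_smul_mem_content_mul hstable hfin h hM hf' hg' 0 1
    (N := 1) (by
      have e : (X + C (-(ρ * α / β))) * (X + C (-(τ - ρ * α / β))) =
          (X ^ 2 - C t * X + C (r * q)).map (algebraMap D K) := by
        have e2 : (ρ * α / β) * (τ - ρ * α / β) = ρ * κ := by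
          field_simp
          linear_combination -ρ * hrq
        have e3 := congrArg C e2
        simp only [C_mul, C_sub] at e3
        simp only [Polynomial.map_add, Polynomial.map_sub, Polynomial.map_mul, Polynomial.map_pow,
          map_X, map_C, C_neg, C_sub, map_mul]
        linear_combination e3
      intro k
      rw [e, coeff_map]
      exact Submodule.mem_one.2 ⟨_, rfl⟩)
  simp only [coeff_add, coeff_X_zero, coeff_X_one, coeff_C_zero, coeff_C_succ, zero_add, add_zero,
    mul_one] at humem
  obtain ⟨d, hd⟩ := Submodule.mem_one.1 (Submodule.neg_mem _ humem)
  rw [Algebra.smul_def] at hd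
  have hd' : algebraMap D K d * β = algebraMap D K u * ρ * α := by
    rw [hd]
    field_simp
  -- Here `d = u z`. As `d + (u t - d) = u t ∉ M`, one of the two summands lies outside `M` and
  -- serves as multiplier: `d b = u r a` and `(u t - d) a = u q b`.
  by_cases hdM : d ∈ M
  · refine ⟨u * t - d, fun hmem => ?_, Or.inl ⟨u * q, hinj ?_⟩⟩
    · have : u * t ∈ M := by simpa using M.add_mem hmem hdM
      exact (Ideal.IsPrime.mem_or_mem inferInstance this).elim hu ht
    · simp only [map_mul, map_sub]
      refine mul_right_cancel₀ hb0 ?_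
      linear_combination (-α) * hd' - algebraMap D K u * hrq
  · refine ⟨d, hdM, Or.inr ⟨u * r, hinj ?_⟩⟩
    simp only [map_mul]
    linear_combination hd'

theorem isInvertible_of_dvdTotalAt {s : SemistarOperation D K} (hstable : s.IsStable)
    (hfin : s.IsFiniteType) (h : ∀ M, s.IsQuasiMaximal M → M.DvdTotalAt) {I : Ideal D}
    (hI : I ≠ ⊥) (hfg : I.FG) : s.IsInvertible I hI := by
  refine le_antisymm (s.mono _ _ ?_) (le_of_forall_isQuasiMaximal hstable hfin ?_)
  · change (ofIdeal K I hI).1 * (1 / (ofIdeal K I hI).1) ≤ 1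
    exact Submodule.mul_one_div_le_one
  intro x hx M hM
  have := hM.isPrime
  obtain ⟨d, rfl⟩ := Submodule.mem_one.1 hx
  have hFG : (ofIdeal K I hI).1.FG := Submodule.FG.map _ hfg
  obtain ⟨a, ha, t, ht, hat⟩ := (h M hM).exists_smul_mem_span hFG
  have ha0 : a ≠ 0 := by
    rintro rfl
    obtain ⟨y, hy, hy0⟩ := (ofIdeal K I hI).exists_ne_zero
    have := hat y hy
    rw [Submodule.span_zero_singleton, Submodule.mem_bot, Algebra.smul_def, mul_eq_zero,
      map_eq_zero_iff _ (IsFractionRing.injective D K)] at this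
    exact this.elim (fun h0 => ht (h0 ▸ M.zero_mem)) hy0
  refine ⟨t, ht, ?_⟩
  -- Since `t I ⊆ D a`, the element `t / a` lies in `I⁻¹`, and `a · (t / a) = t` puts `t` in `I
  -- I⁻¹`.
  have hinv : algebraMap D K t * a⁻¹ ∈ (invIdeal K I hI).1 := by
    refine Submodule.mem_div_iff_forall_mul_mem.2 fun y hy => ?_
    obtain ⟨c, hc⟩ := Submodule.mem_span_singleton.1 (hat y hy)
    refine Submodule.mem_one.2 ⟨c, ?_⟩
    simp only [Algebra.smul_def] at hc
    field_simp
    linear_combination hc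
  have e : t • algebraMap D K d = d • (a * (algebraMap D K t * a⁻¹)) := by
    simp only [Algebra.smul_def]
    field_simp
  rw [e]
  exact Submodule.smul_mem _ _ (Submodule.mul_mem_mul ha hinv)

theorem dvdTotalAt_of_isInvertible {s : SemistarOperation D K} (hstable : s.IsStable)
    (hfin : s.IsFiniteType) (h : ∀ (I : Ideal D) (hI : I ≠ ⊥), I.FG → s.IsInvertible I hI)
    {M : Ideal D} (hM : s.IsQuasiMaximal M) : M.DvdTotalAt := by
  have := hM.isPrime
  intro a b
  by_cases ha : a = 0
  · exact ⟨1, M.one_notMem, Or.inl (by simp [ha])⟩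
  have hinj := IsFractionRing.injective D K
  have hI : Ideal.span {a, b} ≠ ⊥ := fun e =>
    ha ((Submodule.mem_bot D).1 (e ▸ Ideal.subset_span (by simp)))
  have hinv := h _ hI (Submodule.fg_span (by simp))
  have h1 : (1 : K) ∈ (s (ofIdeal K _ hI * invIdeal K _ hI)).1 := by
    rw [hinv]
    exact s.le_map 1 (Submodule.one_le.1 le_rfl)
  obtain ⟨t, ht, htmem⟩ := (mem_iff_forall_isQuasiMaximal hstable hfin _ _).1 h1 M hM
  by_contra hcon
  have hprod : ∀ c ∈ ({a, b} : Set D), ∀ z ∈ (invIdeal K _ hI).1,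
      ∃ d, algebraMap D K d = z * algebraMap D K c := fun c hc z hz =>
    Submodule.mem_one.1 (Submodule.mem_div_iff_forall_mul_mem.1 hz _
      ⟨c, Ideal.subset_span hc, rfl⟩)
  -- Both `z a` and `z b` lie in `D`, and `(z a) b = (z b) a`; if either were outside `M`, it would
  -- be a multiplier witnessing the excluded divisibility.
  have hgen : ∀ c ∈ ({a, b} : Set D), ∀ z ∈ (invIdeal K _ hI).1,
      algebraMap D K c * z ∈ Submodule.map (Algebra.linearMap D K) M := by
    intro c hc z hz
    obtain ⟨d₁, hd₁⟩ := hprod a (by simp) z hz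
    obtain ⟨d₂, hd₂⟩ := hprod b (by simp) z hz
    have hab : d₁ * b = d₂ * a := hinj (by
      rw [map_mul, map_mul, hd₁, hd₂]
      ring)
    obtain rfl | rfl := hc
    · refine ⟨d₁, by_contra fun hd => hcon ⟨d₁, hd, Or.inr ⟨d₂, ?_⟩⟩, ?_⟩
      · rw [hab, mul_comm]
      · rw [Algebra.linearMap_apply, hd₁, mul_comm]
    · refine ⟨d₂, by_contra fun hd => hcon ⟨d₂, hd, Or.inl ⟨d₁, ?_⟩⟩, ?_⟩
      · rw [← hab, mul_comm]
      · rw [Algebra.linearMap_apply, hd₂, mul_comm]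
  have hle : (ofIdeal K _ hI).1 * (invIdeal K _ hI).1 ≤ Submodule.map (Algebra.linearMap D K) M := by
    refine Submodule.mul_le.2 ?_
    rintro _ ⟨c, hc, rfl⟩ z hz
    obtain ⟨p, q, rfl⟩ := Ideal.mem_span_pair.1 hc
    have e : Algebra.linearMap D K (p * a + q * b) * z =
        p • (algebraMap D K a * z) + q • (algebraMap D K b * z) := by
      simp only [Algebra.linearMap_apply, map_add, map_mul, Algebra.smul_def]
      ring
    rw [e]
    exact Submodule.add_mem _ (Submodule.smul_mem _ _ (hgen a (by simp) z hz))
      (Submodule.smul_mem _ _ (hgen b (by simp) z hz))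
  -- Invertibility put `t ∉ M` into `I I⁻¹`, now seen to lie in `M`.
  obtain ⟨m, hm, hmt⟩ := hle htmem
  refine ht ?_
  have : m = t := hinj (by simpa [Algebra.smul_def] using hmt)
  exact this ▸ hm

end SemistarOperation

theorem theorem1p1 {D K : Type*} [CommRing D] [IsDomain D] [Field K] [Algebra D K]
    [IsFractionRing D K] (s : SemistarOperation D K) (hstable : s.IsStable)
    (hfin : s.IsFiniteType) :
    List.TFAE [
      ∀ (f g : K[X]) (hf : f ≠ 0) (hg : g ≠ 0),
        s (NonzeroSubmodule.content D (f * g) (mul_ne_zero hf hg)) =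
          s (NonzeroSubmodule.content D f hf * NonzeroSubmodule.content D g hg),
      ∀ (M : Ideal D) (hM : s.IsQuasiMaximal M),
        haveI := hM.isPrime
        ValuationRing (Localization.AtPrime M),
      s.IsPruferMultiplicationDomain] := by
  have hval : (∀ (M : Ideal D) (hM : s.IsQuasiMaximal M),
      haveI := hM.isPrime
      ValuationRing (Localization.AtPrime M)) ↔ ∀ M, s.IsQuasiMaximal M → M.DvdTotalAt :=
    forall₂_congr fun M hM =>
      haveI := hM.isPrime
      M.valuationRing_localization_iff
  have hprufer : s.IsPruferMultiplicationDomain ↔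
      ∀ (I : Ideal D) (hI : I ≠ ⊥), I.FG → s.IsInvertible I hI := by
    rw [SemistarOperation.IsPruferMultiplicationDomain, ← hfin]
  rw [hval, hprufer]
  tfae_have 1 → 2 := fun h _ hM =>
    SemistarOperation.dvdTotalAt_of_eq_content_mul hstable hfin h hM
  tfae_have 2 → 1 := fun h _ _ hf hg =>
    SemistarOperation.eq_content_mul_of_dvdTotalAt hstable hfin h hf hg
  tfae_have 2 → 3 := fun h _ hI hfg =>
    SemistarOperation.isInvertible_of_dvdTotalAt hstable hfin h hI hfg
  tfae_have 3 → 2 := fun h _ hM =>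
    SemistarOperation.dvdTotalAt_of_isInvertible hstable hfin h hM
  tfae_finish
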